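/- There exists a strictly increasing absolutely continuous function $f:[0,1]\to\mathbb R$ such that the set $\{x\in[0,1] : f'(x)\text{ exists and } f'(x)=0\}$ is both countable and dense in $[0,1]$. (At the endpoints $0$ and $1$, $f'$ denotes the one-sided derivative.) -/

import Mathlib

open MeasureTheory Set Filter Topology

/-! Let `q` enumerate the rationals and let `f` be the integral of a density `g` with values in `[0,
1]`, positive off the range of `q`. Then `f` is 1-Lipschitz and strictly increasing. On the ball
about `q n`, minus all later balls, `g` is `|x - q n| / r n`. At a centre `g` vanishes linearly, and
the later balls disturb this only to second order, so increments of `f` are quadratic and `f' = 0`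
(`hasDerivAt_zero`). Off the centres `f' = 0` fails. If `x` is within `2 * r n` of infinitely many
`q n`, each such core alone carries mass comparable to `r n`. Otherwise late cores near `x` keep a
fixed share of their volume as mass, and elsewhere near `x` the density is bounded below. -/

/-- Positive radii decaying so fast that the ball about `q n` is negligible, to second order,
relative to its distance from every earlier centre. -/
structure SparseRadii (q r : ℕ → ℝ) : Prop where
  pos : ∀ n, 0 < r n
  decay : ∀ n, r (n + 1) ≤ r n / 8
  le_sq : ∀ m n, m < n → r n ≤ (1 / 2) ^ n * (q n - q m) ^ 2
  le_half : ∀ m n, m < n → r n ≤ |q n - q m| / 2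

theorem exists_sparseRadii {q : ℕ → ℝ} (hq : Function.Injective q) :
    ∃ r, SparseRadii q r := by
  -- Factors capped at 1 make `w n` at most each squared distance to an earlier centre.
  let w : ℕ → ℝ := fun n => ∏ m ∈ Finset.range n, min 1 ((q n - q m) ^ 2)
  have hfac0 : ∀ m n, m < n → 0 < min 1 ((q n - q m) ^ 2) := fun m n h => by
    have : q n - q m ≠ 0 := sub_ne_zero.2 fun e => h.ne' (hq e)
    positivity
  have hw0 : ∀ n, 0 < w n := fun n =>
    Finset.prod_pos fun m hm => hfac0 m n (Finset.mem_range.1 hm)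
  have hw1 : ∀ n, w n ≤ 1 := fun n =>
    Finset.prod_le_one (fun m hm => (hfac0 m n (Finset.mem_range.1 hm)).le)
      fun m _ => min_le_left _ _
  have hwm : ∀ m n, m < n → w n ≤ min 1 ((q n - q m) ^ 2) := by
    intro m n h
    have hm : m ∈ Finset.range n := Finset.mem_range.2 h
    change ∏ m ∈ Finset.range n, min 1 ((q n - q m) ^ 2) ≤ _
    rw [← Finset.mul_prod_erase _ _ hm]
    refine mul_le_of_le_one_right (hfac0 m n h).le (Finset.prod_le_one ?_ ?_)
    · exact fun k hk => (hfac0 k n (Finset.mem_range.1 (Finset.mem_of_mem_erase hk))).le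
    · exact fun k _ => min_le_left _ _
  -- The cumulative product is also nonincreasing, so the factor `(1 / 8) ^ (n + 1)` yields `decay`.
  let p : ℕ → ℝ := fun n => ∏ j ∈ Finset.range (n + 1), w j
  have hp0 : ∀ n, 0 < p n := fun n => Finset.prod_pos fun j _ => hw0 j
  have hps : ∀ n, p (n + 1) = p n * w (n + 1) := fun n => Finset.prod_range_succ _ _
  have hpw : ∀ n, p n ≤ w n := by
    intro n
    change ∏ j ∈ Finset.range (n + 1), w j ≤ _
    rw [Finset.prod_range_succ]
    exact mul_le_of_le_one_left (hw0 n).le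
      (Finset.prod_le_one (fun j _ => (hw0 j).le) fun j _ => hw1 j)
  have hle : ∀ m n, m < n → (1 / 8 : ℝ) ^ (n + 1) * p n ≤
      (1 / 2) ^ (n + 1) * min 1 ((q n - q m) ^ 2) := by
    intro m n h
    exact mul_le_mul (pow_le_pow_left₀ (by norm_num) (by norm_num) _)
      ((hpw n).trans (hwm m n h)) (hp0 n).le (by positivity)
  refine ⟨fun n => (1 / 8) ^ (n + 1) * p n, ⟨fun n => ?_, fun n => ?_, fun m n h => ?_,
    fun m n h => ?_⟩⟩
  · have := hp0 n
    positivity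
  · have : p (n + 1) ≤ p n := by
      rw [hps]; exact mul_le_of_le_one_right (hp0 n).le (hw1 _)
    have h8 : (0 : ℝ) < (1 / 8) ^ (n + 1) := by positivity
    rw [pow_succ]
    nlinarith [mul_le_mul_of_nonneg_left this h8.le]
  · refine (hle m n h).trans ?_
    have h2 : (0 : ℝ) < (1 / 2) ^ n := by positivity
    refine mul_le_mul ?_ (min_le_right _ _) (hfac0 m n h).le h2.le
    rw [pow_succ]; linarith
  · refine (hle m n h).trans ?_
    have h1 : (1 / 2 : ℝ) ^ (n + 1) ≤ 1 / 2 := by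
      rw [pow_succ]
      have := pow_le_one₀ (n := n) (by norm_num : (0 : ℝ) ≤ 1 / 2) (by norm_num)
      linarith
    have h2 : min 1 ((q n - q m) ^ 2) ≤ |q n - q m| := by
      rw [← sq_abs]
      rcases le_total 1 |q n - q m| with h | h
      · exact (min_le_left _ _).trans h
      · refine (min_le_right _ _).trans ?_
        nlinarith [abs_nonneg (q n - q m)]
    nlinarith [abs_nonneg (q n - q m), hfac0 m n h]

theorem volume_iUnion_le_of_geometric {s : ℕ → Set ℝ} {c : ℝ} (hc : 0 ≤ c)
    (hs : ∀ k, volume (s k) ≤ ENNReal.ofReal (c * (1 / 2) ^ k)) :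
    volume (⋃ k, s k) ≤ ENNReal.ofReal (2 * c) := by
  refine (measure_iUnion_le s).trans ((ENNReal.tsum_le_tsum hs).trans ?_)
  rw [← ENNReal.ofReal_tsum_of_nonneg (fun k => by positivity)
    (summable_geometric_two.mul_left c), tsum_mul_left, tsum_geometric_two, mul_comm]

namespace SparseRadii

variable {q r : ℕ → ℝ}

theorem add_le (h : SparseRadii q r) (n k : ℕ) : r (n + k) ≤ r n * (1 / 2) ^ k := by
  induction k with
  | zero => simp
  | succ k ih =>
    have := h.decay (n + k)
    have := h.pos (n + k)
    rw [← add_assoc, pow_succ]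
    linarith

theorem tendsto_zero (h : SparseRadii q r) : Tendsto r atTop (𝓝 0) := by
  have : Tendsto (fun k : ℕ => r 0 * (1 / 2 : ℝ) ^ k) atTop (𝓝 0) := by
    simpa using (tendsto_pow_atTop_nhds_zero_of_lt_one (by norm_num : (0 : ℝ) ≤ 1 / 2)
      (by norm_num)).const_mul (r 0)
  exact squeeze_zero (fun n => (h.pos n).le) (fun n => by simpa using h.add_le 0 n) this

end SparseRadii

/-! ### Cores and the volume of later balls -/

/-- The union of the balls with index larger than `n`. -/
def laterBalls (q r : ℕ → ℝ) (n : ℕ) : Set ℝ :=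
  ⋃ k, Metric.closedBall (q (n + 1 + k)) (r (n + 1 + k))

/-- The `n`-th ball without the later ones. -/
def core (q r : ℕ → ℝ) (n : ℕ) : Set ℝ :=
  Metric.closedBall (q n) (r n) \ laterBalls q r n

section

variable {q r : ℕ → ℝ}

theorem mem_laterBalls {n : ℕ} {x : ℝ} :
    x ∈ laterBalls q r n ↔ ∃ k > n, x ∈ Metric.closedBall (q k) (r k) := by
  simp only [laterBalls, mem_iUnion]
  constructor
  · rintro ⟨k, hk⟩; exact ⟨_, by omega, hk⟩
  · rintro ⟨k, hk, hx⟩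
    obtain ⟨j, rfl⟩ := Nat.exists_eq_add_of_le (show n + 1 ≤ k from hk)
    exact ⟨j, hx⟩

theorem measurableSet_laterBalls (n : ℕ) : MeasurableSet (laterBalls q r n) :=
  MeasurableSet.iUnion fun _ => measurableSet_closedBall

theorem measurableSet_core (n : ℕ) : MeasurableSet (core q r n) :=
  measurableSet_closedBall.diff (measurableSet_laterBalls n)

theorem core_subset (n : ℕ) : core q r n ⊆ Metric.closedBall (q n) (r n) := sdiff_subset

theorem pairwise_disjoint_core : Pairwise (Function.onFun Disjoint (core q r)) := by
  have key : ∀ m n, m < n → Disjoint (core q r m) (core q r n) := by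
    intro m n h
    rw [Set.disjoint_left]
    exact fun x hm hn => hm.2 (mem_laterBalls.2 ⟨n, h, core_subset n hn⟩)
  intro m n h
  rcases lt_or_gt_of_ne h with h | h
  · exact key m n h
  · exact (key n m h).symm

theorem SparseRadii.volume_laterBalls_le (h : SparseRadii q r) (n : ℕ) :
    volume (laterBalls q r n) ≤ ENNReal.ofReal (r n / 2) := by
  have hn := h.pos n
  rw [show r n / 2 = 2 * (r n / 4) by ring]
  refine volume_iUnion_le_of_geometric (by positivity) fun k => ?_
  rw [Real.volume_closedBall]
  apply ENNReal.ofReal_le_ofReal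
  have h1 := h.add_le (n + 1) k
  have h2 := h.decay n
  have h3 : (0 : ℝ) < (1 / 2) ^ k := by positivity
  nlinarith [mul_le_mul_of_nonneg_right h2 h3.le]

/-- Near an earlier centre the later balls have second order measure. -/
theorem SparseRadii.volume_laterBalls_inter_le (h : SparseRadii q r) (m : ℕ) {δ : ℝ}
    (hδ : 0 ≤ δ) :
    volume (laterBalls q r m ∩ Metric.closedBall (q m) δ) ≤ ENNReal.ofReal (16 * δ ^ 2) := by
  rw [laterBalls, iUnion_inter, show 16 * δ ^ 2 = 2 * (8 * δ ^ 2) by ring]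
  refine volume_iUnion_le_of_geometric (by positivity) fun k => ?_
  set n := m + 1 + k with hn
  rcases (Metric.closedBall (q n) (r n) ∩ Metric.closedBall (q m) δ).eq_empty_or_nonempty with
    he | ⟨y, hy1, hy2⟩
  · simp [he]
  refine (measure_mono inter_subset_left).trans ?_
  rw [Real.volume_closedBall]
  apply ENNReal.ofReal_le_ofReal
  have hmn : m < n := by omega
  have h1 := h.le_sq m n hmn
  have h2 := h.le_half m n hmn
  rw [Metric.mem_closedBall, Real.dist_eq] at hy1 hy2
  have h3 : |q n - q m| ≤ |y - q n| + |y - q m| := by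
    rw [abs_sub_comm y (q n)]; exact abs_sub_le _ _ _
  -- `le_half` absorbs `|y - q n|`: a later ball reaching within `δ` of `q m` has its centre within
  -- `2 * δ`.
  have h4 : |q n - q m| ≤ 2 * δ := by linarith
  have h5 : (q n - q m) ^ 2 ≤ 4 * δ ^ 2 := by
    rw [← sq_abs]; nlinarith [abs_nonneg (q n - q m)]
  have h6 : (1 / 2 : ℝ) ^ n ≤ (1 / 2) ^ k :=
    pow_le_pow_of_le_one (by norm_num) (by norm_num) (by omega)
  have h7 : (1 / 2 : ℝ) ^ n * (q n - q m) ^ 2 ≤ (1 / 2) ^ k * (4 * δ ^ 2) :=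
    mul_le_mul h6 h5 (sq_nonneg _) (by positivity)
  linarith

end

/-! ### The density and its integral -/

/-- A density equal to `|x - q n| / r n` on the `n`-th core and to `1` off the cores. -/
structure CoreDensity (q r : ℕ → ℝ) (g : ℝ → ℝ) : Prop where
  measurable : Measurable g
  eq_of_mem : ∀ n, ∀ x ∈ core q r n, g x = |x - q n| / r n
  eq_one : ∀ x, (∀ n, x ∉ core q r n) → g x = 1

theorem exists_coreDensity (q r : ℕ → ℝ) : ∃ g, CoreDensity q r g := by
  classical
  obtain ⟨g, hg, hgc⟩ := exists_measurable_piecewise (core q r) measurableSet_core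
    (fun n x => |x - q n| / r n) (fun n => by fun_prop) (fun i j hij x hx =>
      absurd hx.2 (Set.disjoint_left.1 (pairwise_disjoint_core hij) hx.1))
  refine ⟨(⋃ n, core q r n).piecewise g 1, ⟨?_, fun n x hx => ?_, fun x hx => ?_⟩⟩
  · exact hg.piecewise (MeasurableSet.iUnion measurableSet_core) measurable_const
  · rw [piecewise_eq_of_mem _ _ _ (mem_iUnion.2 ⟨n, hx⟩)]; exact hgc n hx
  · rw [piecewise_eq_of_notMem _ _ _ (by simpa using hx)]; rfl

/-- The measure with density `g`. -/
noncomputable def mass (g : ℝ → ℝ) : Measure ℝ :=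
  volume.withDensity fun x => ENNReal.ofReal (g x)

theorem ofReal_mul_volume_le_mass {g : ℝ → ℝ} {s : Set ℝ} (hs : MeasurableSet s) {c : ℝ}
    (h : ∀ x ∈ s, c ≤ g x) : ENNReal.ofReal c * volume s ≤ mass g s := by
  rw [mass, withDensity_apply _ hs, ← setLIntegral_const]
  exact setLIntegral_mono' hs fun x hx => ENNReal.ofReal_le_ofReal (h x hx)

theorem mass_le_ofReal_mul_volume {g : ℝ → ℝ} {s : Set ℝ} (hs : MeasurableSet s) {c : ℝ}
    (h : ∀ x ∈ s, g x ≤ c) : mass g s ≤ ENNReal.ofReal c * volume s := by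
  rw [mass, withDensity_apply _ hs, ← setLIntegral_const]
  exact setLIntegral_mono' hs fun x hx => ENNReal.ofReal_le_ofReal (h x hx)

namespace CoreDensity

variable {q r : ℕ → ℝ} {g : ℝ → ℝ}

theorem nonneg (hg : CoreDensity q r g) (hr : SparseRadii q r) (x : ℝ) : 0 ≤ g x := by
  by_cases h : ∀ n, x ∉ core q r n
  · rw [hg.eq_one x h]; norm_num
  · push Not at h
    obtain ⟨n, hn⟩ := h
    rw [hg.eq_of_mem n x hn]
    exact div_nonneg (abs_nonneg _) (hr.pos n).le

theorem le_one (hg : CoreDensity q r g) (hr : SparseRadii q r) (x : ℝ) : g x ≤ 1 := by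
  by_cases h : ∀ n, x ∉ core q r n
  · exact (hg.eq_one x h).le
  · push Not at h
    obtain ⟨n, hn⟩ := h
    rw [hg.eq_of_mem n x hn]
    exact div_le_one_of_le₀ (core_subset n hn) (hr.pos n).le

theorem pos (hg : CoreDensity q r g) (hr : SparseRadii q r) {x : ℝ} (hx : x ∉ range q) :
    0 < g x := by
  by_cases h : ∀ n, x ∉ core q r n
  · rw [hg.eq_one x h]; norm_num
  · push Not at h
    obtain ⟨n, hn⟩ := h
    rw [hg.eq_of_mem n x hn]
    exact div_pos (abs_pos.2 (sub_ne_zero.2 fun e => hx ⟨n, e.symm⟩)) (hr.pos n)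

theorem intervalIntegrable (hg : CoreDensity q r g) (hr : SparseRadii q r) (a b : ℝ) :
    IntervalIntegrable g volume a b := by
  refine (intervalIntegrable_const (c := (1 : ℝ))).mono_fun
    hg.measurable.aestronglyMeasurable (Eventually.of_forall fun x => ?_)
  simpa [abs_of_nonneg (hg.nonneg hr x)] using hg.le_one hr x

theorem integral_sub (hg : CoreDensity q r g) (hr : SparseRadii q r) (a b : ℝ) :
    (∫ t in 0..b, g t) - ∫ t in 0..a, g t = ∫ t in a..b, g t :=
  intervalIntegral.integral_interval_sub_left (hg.intervalIntegrable hr _ _)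
    (hg.intervalIntegrable hr _ _)

theorem ofReal_integral (hg : CoreDensity q r g) (hr : SparseRadii q r) {a b : ℝ} (hab : a ≤ b) :
    ENNReal.ofReal (∫ t in a..b, g t) = mass g (Ioc a b) := by
  rw [intervalIntegral.integral_of_le hab, mass, withDensity_apply _ measurableSet_Ioc,
    ofReal_integral_eq_lintegral_ofReal (hg.intervalIntegrable hr a b).1
      (Eventually.of_forall fun x => hg.nonneg hr x)]

theorem strictMono (hg : CoreDensity q r g) (hr : SparseRadii q r) :
    StrictMono fun x => ∫ t in 0..x, g t := by
  intro a b hab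
  rw [← sub_pos, hg.integral_sub hr, ← ENNReal.ofReal_pos, hg.ofReal_integral hr hab.le,
    pos_iff_ne_zero, mass]
  intro h0
  rw [withDensity_apply_eq_zero hg.measurable.ennreal_ofReal] at h0
  -- A null mass would leave only centres in the interval, which are countable.
  have hsub : Ioc a b ⊆ ({x | ENNReal.ofReal (g x) ≠ 0} ∩ Ioc a b) ∪ range q := by
    intro x hx
    by_cases hxq : x ∈ range q
    · exact Or.inr hxq
    · exact Or.inl ⟨(ENNReal.ofReal_pos.2 (hg.pos hr hxq)).ne', hx⟩
  have := measure_mono_null hsub (measure_union_null h0 ((countable_range q).measure_zero volume))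
  rw [Real.volume_Ioc, ENNReal.ofReal_eq_zero] at this
  linarith

theorem lipschitzWith (hg : CoreDensity q r g) (hr : SparseRadii q r) :
    LipschitzWith 1 fun x => ∫ t in 0..x, g t := by
  refine LipschitzWith.of_dist_le_mul fun x y => ?_
  rw [Real.dist_eq, hg.integral_sub hr, Real.dist_eq]
  simpa using intervalIntegral.norm_integral_le_of_norm_le_const (C := 1) (f := g) (a := y)
    (b := x) fun t _ => by
      simpa [abs_of_nonneg (hg.nonneg hr t)] using hg.le_one hr t

theorem le_mass_core (hg : CoreDensity q r g) (hr : SparseRadii q r) (n : ℕ) :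
    ENNReal.ofReal (r n / 4) ≤ mass g (core q r n) := by
  have hn := hr.pos n
  -- On the outer shell `g ≥ 1 / 2`; its volume is `r n`, and later balls remove at most half of it.
  set T := (Metric.closedBall (q n) (r n) \ Metric.ball (q n) (r n / 2)) \ laterBalls q r n
  have hT : MeasurableSet T :=
    (measurableSet_closedBall.diff measurableSet_ball).diff (measurableSet_laterBalls n)
  have hTc : T ⊆ core q r n := fun x hx => ⟨hx.1.1, hx.2⟩
  have hvol : ENNReal.ofReal (r n / 2) ≤ volume T := by
    refine le_trans ?_ le_measure_sdiff
    refine le_trans ?_ (tsub_le_tsub le_measure_sdiff (hr.volume_laterBalls_le n))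
    rw [Real.volume_closedBall, Real.volume_ball, ← ENNReal.ofReal_sub _ (by positivity),
      ← ENNReal.ofReal_sub _ (by positivity)]
    exact ENNReal.ofReal_le_ofReal (by linarith)
  calc ENNReal.ofReal (r n / 4) = ENNReal.ofReal (1 / 2) * ENNReal.ofReal (r n / 2) := by
        rw [← ENNReal.ofReal_mul (by norm_num)]; congr 1; ring
    _ ≤ ENNReal.ofReal (1 / 2) * volume T := by gcongr
    _ ≤ mass g T := ofReal_mul_volume_le_mass hT fun x hx => by
        rw [hg.eq_of_mem n x (hTc hx), le_div_iff₀ hn]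
        have : r n / 2 ≤ |x - q n| := by simpa [Real.dist_eq] using hx.1.2
        linarith
    _ ≤ mass g (core q r n) := measure_mono hTc

theorem volume_core_le_mass (hg : CoreDensity q r g) (hr : SparseRadii q r) (n : ℕ) :
    ENNReal.ofReal (1 / 8) * volume (core q r n) ≤ mass g (core q r n) := by
  refine le_trans ?_ (hg.le_mass_core hr n)
  calc ENNReal.ofReal (1 / 8) * volume (core q r n)
      ≤ ENNReal.ofReal (1 / 8) * ENNReal.ofReal (2 * r n) := by
        rw [← Real.volume_closedBall (q n)]
        gcongr
        exact core_subset n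
    _ = ENNReal.ofReal (r n / 4) := by
        rw [← ENNReal.ofReal_mul (by norm_num)]; congr 1; ring

/-- The term 16 comes from later balls, where only `g ≤ 1` is used; the term `2 / r m` comes from
the core, where `g ≤ δ / r m`. -/
theorem mass_closedBall_le (hg : CoreDensity q r g) (hr : SparseRadii q r) (m : ℕ) {δ : ℝ}
    (hδ : 0 ≤ δ) (hδr : δ ≤ r m) :
    mass g (Metric.closedBall (q m) δ) ≤ ENNReal.ofReal ((16 + 2 / r m) * δ ^ 2) := by
  have hm := hr.pos m
  set B := Metric.closedBall (q m) δ
  have hB : MeasurableSet B := measurableSet_closedBall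
  have hL : MeasurableSet (laterBalls q r m) := measurableSet_laterBalls m
  rw [← measure_inter_add_sdiff B hL, add_mul,
    ENNReal.ofReal_add (by positivity) (by positivity)]
  gcongr ?_ + ?_
  · refine (mass_le_ofReal_mul_volume (hB.inter hL) fun x _ => hg.le_one hr x).trans ?_
    rw [ENNReal.ofReal_one, one_mul, inter_comm]
    exact hr.volume_laterBalls_inter_le m hδ
  · have hle : ∀ x ∈ B \ laterBalls q r m, g x ≤ δ / r m := by
      rintro x ⟨hxB, hxL⟩
      rw [hg.eq_of_mem m x ⟨Metric.closedBall_subset_closedBall hδr hxB, hxL⟩]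
      gcongr
      exact hxB
    refine (mass_le_ofReal_mul_volume (hB.diff hL) hle).trans ?_
    calc ENNReal.ofReal (δ / r m) * volume (B \ laterBalls q r m)
        ≤ ENNReal.ofReal (δ / r m) * volume B := by gcongr; exact sdiff_subset
      _ = ENNReal.ofReal (2 / r m * δ ^ 2) := by
        rw [Real.volume_closedBall, ← ENNReal.ofReal_mul (by positivity)]
        congr 1; ring

theorem hasDerivAt_zero (hg : CoreDensity q r g) (hr : SparseRadii q r) (m : ℕ) :
    HasDerivAt (fun x => ∫ t in 0..x, g t) 0 (q m) := by
  have hm := hr.pos m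
  rw [hasDerivAt_iff_isLittleO]
  have hO : (fun x => (∫ t in 0..x, g t) - (∫ t in 0..q m, g t) - (x - q m) • (0 : ℝ)) =O[𝓝 (q m)]
      fun x => (x - q m) ^ 2 := by
    refine Asymptotics.IsBigO.of_bound (16 + 2 / r m) ?_
    filter_upwards [Metric.closedBall_mem_nhds (q m) hm] with x hx
    rw [smul_zero, sub_zero, hg.integral_sub hr]
    have hx' : |x - q m| ≤ r m := hx
    have hb := hg.mass_closedBall_le hr m (abs_nonneg (x - q m)) hx'
    have hC : 0 ≤ (16 + 2 / r m) * |x - q m| ^ 2 := by positivity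
    have key : ∀ a b : ℝ, a ≤ b → Ioc a b ⊆ Metric.closedBall (q m) |x - q m| →
        |∫ t in a..b, g t| ≤ (16 + 2 / r m) * |x - q m| ^ 2 := by
      intro a b hab hs
      rw [abs_of_nonneg (intervalIntegral.integral_nonneg hab fun t _ => hg.nonneg hr t),
        ← ENNReal.ofReal_le_ofReal_iff hC, hg.ofReal_integral hr hab]
      exact (measure_mono hs).trans hb
    rw [Real.norm_eq_abs, norm_pow, Real.norm_eq_abs]
    rcases le_total (q m) x with hle | hle
    · refine key _ _ hle fun y hy => ?_
      rw [Metric.mem_closedBall, Real.dist_eq, abs_of_nonneg (sub_nonneg.2 hy.1.le),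
        abs_of_nonneg (sub_nonneg.2 hle)]
      linarith [hy.2]
    · rw [intervalIntegral.integral_symm, abs_neg]
      refine key _ _ hle fun y hy => ?_
      rw [Metric.mem_closedBall, Real.dist_eq, abs_of_nonpos (sub_nonpos.2 hy.2),
        abs_of_nonpos (sub_nonpos.2 hle)]
      linarith [hy.1]
  refine hO.trans_isLittleO ?_
  have h1 : Tendsto (fun x => x - q m) (𝓝 (q m)) (𝓝 0) := by
    simpa using (continuous_sub_right (q m)).tendsto (q m)
  simpa [pow_two] using ((Asymptotics.isLittleO_one_iff ℝ).2 h1).mul_isBigO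
    (Asymptotics.isBigO_refl (fun x => x - q m) (𝓝 (q m)))

/-! ### Nonvanishing of the derivative off the centres -/

theorem mass_closedBall_le_of_hasDerivAt_zero (hg : CoreDensity q r g) (hr : SparseRadii q r)
    {x : ℝ} (hx : HasDerivAt (fun x => ∫ t in 0..x, g t) 0 x) {ε : ℝ} (hε : 0 < ε) :
    ∃ δ₀ > 0, ∀ δ, 0 < δ → δ < δ₀ → mass g (Metric.closedBall x δ) ≤ ENNReal.ofReal (ε * δ) := by
  rw [hasDerivAt_iff_isLittleO] at hx
  obtain ⟨δ₀, hδ₀, H⟩ := Metric.eventually_nhds_iff.1 (hx.def (show 0 < ε / 4 by positivity))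
  refine ⟨δ₀ / 2, by positivity, fun δ hδ hlt => ?_⟩
  have h1 := @H (x + δ) (by simpa [Real.dist_eq, abs_of_pos hδ] using by linarith)
  -- The left end is moved to `x - 2 * δ` because `Ioc` omits it; the increment is at most `ε / 4 *
  -- (δ + 2 * δ)`.
  have h2 := @H (x - 2 * δ) (by
    rw [Real.dist_eq, sub_sub_cancel_left, abs_neg, abs_of_pos (by positivity)]; linarith)
  have hsub : Metric.closedBall x δ ⊆ Ioc (x - 2 * δ) (x + δ) := by
    rw [Real.closedBall_eq_Icc]
    exact fun y hy => ⟨by linarith [hy.1], hy.2⟩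
  refine (measure_mono hsub).trans ?_
  rw [← hg.ofReal_integral hr (by linarith), ← hg.integral_sub hr]
  apply ENNReal.ofReal_le_ofReal
  simp only [smul_zero, sub_zero, Real.norm_eq_abs] at h1 h2
  rw [add_sub_cancel_left, abs_of_pos hδ] at h1
  rw [sub_sub_cancel_left, abs_neg, abs_of_pos (by positivity : 0 < 2 * δ)] at h2
  have := (abs_le.1 h1).2
  have := (abs_le.1 h2).1
  nlinarith [mul_pos hε hδ]

/-- Away from the centres, `g` is locally bounded below off the cores of large index. -/
theorem exists_le_off_cores (hg : CoreDensity q r g) (hr : SparseRadii q r) {x : ℝ}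
    (hx : x ∉ range q) (N : ℕ) :
    ∃ c > 0, c ≤ 1 / 8 ∧ ∀ᶠ y in 𝓝 x, (∀ n > N, y ∉ core q r n) → c ≤ g y := by
  have h1 : ∀ n, ∃ c > 0, ∀ᶠ y in 𝓝 x, c ≤ |y - q n| / r n := by
    intro n
    have hp : 0 < |x - q n| / r n :=
      div_pos (abs_pos.2 (sub_ne_zero.2 fun e => hx ⟨n, e.symm⟩)) (hr.pos n)
    refine ⟨|x - q n| / r n / 2, by positivity, ?_⟩
    have hc : ContinuousAt (fun y => |y - q n| / r n) x := by fun_prop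
    exact (hc.eventually (lt_mem_nhds (half_lt_self hp))).mono fun y hy => hy.le
  choose c hc hcy using h1
  obtain ⟨n₀, -, hn₀⟩ := (Finset.range (N + 1)).exists_min_image c
    ⟨0, Finset.mem_range.2 N.succ_pos⟩
  -- The cap `1 / 8` is the mass-to-volume ratio in `volume_core_le_mass`, so one constant serves on
  -- and off the late cores.
  refine ⟨min (c n₀) (1 / 8), lt_min (hc _) (by norm_num), min_le_right _ _, ?_⟩
  have hall : ∀ᶠ y in 𝓝 x, ∀ n ∈ Finset.range (N + 1), c n ≤ |y - q n| / r n :=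
    (Finset.eventually_all _).2 fun n _ => hcy n
  filter_upwards [hall] with y hy hN
  by_cases h : ∀ n, y ∉ core q r n
  · rw [hg.eq_one y h]
    exact (min_le_right _ _).trans (by norm_num)
  · push Not at h
    obtain ⟨n, hn⟩ := h
    have hnN : n ∈ Finset.range (N + 1) := by
      by_contra hcon
      rw [Finset.mem_range, not_lt] at hcon
      exact hN n hcon hn
    rw [hg.eq_of_mem n y hn]
    exact (min_le_left _ _).trans ((hn₀ n hnN).trans (hy n hnN))

theorem not_hasDerivAt_zero_of_frequently (hg : CoreDensity q r g) (hr : SparseRadii q r) {x : ℝ}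
    (hx : ∃ᶠ n in atTop, |x - q n| ≤ 2 * r n) :
    ¬ HasDerivAt (fun x => ∫ t in 0..x, g t) 0 x := by
  intro hd
  obtain ⟨δ₀, hδ₀, H⟩ := hg.mass_closedBall_le_of_hasDerivAt_zero hr hd
    (show (0 : ℝ) < 1 / 32 by norm_num)
  have hsmall : ∀ᶠ n in atTop, r n < δ₀ / 4 :=
    hr.tendsto_zero.eventually (gt_mem_nhds (by positivity))
  obtain ⟨n, hn, hnδ⟩ := (hx.and_eventually hsmall).exists
  have hpos := hr.pos n
  -- The upper bound is `r n / 8`, while the core has mass at least `r n / 4`.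
  have h1 := H (4 * r n) (by positivity) (by linarith)
  have hsub : core q r n ⊆ Metric.closedBall x (4 * r n) := by
    refine (core_subset n).trans (Metric.closedBall_subset_closedBall' ?_)
    rw [dist_comm, Real.dist_eq]
    linarith
  have h2 := ((hg.le_mass_core hr n).trans (measure_mono hsub)).trans h1
  rw [ENNReal.ofReal_le_ofReal_iff (by positivity)] at h2
  linarith

theorem not_hasDerivAt_zero_of_eventually (hg : CoreDensity q r g) (hr : SparseRadii q r) {x : ℝ}
    (hxq : x ∉ range q) (hx : ∀ᶠ n in atTop, 2 * r n < |x - q n|) :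
    ¬ HasDerivAt (fun x => ∫ t in 0..x, g t) 0 x := by
  intro hd
  obtain ⟨N, hN⟩ := eventually_atTop.1 hx
  obtain ⟨c, hc, hc8, hcy⟩ := hg.exists_le_off_cores hr hxq N
  obtain ⟨δ₁, hδ₁, hball⟩ := Metric.eventually_nhds_iff.1 hcy
  -- With `c / 3` the ball of radius `3 * δ` has mass at most `c * δ`, against the lower bound `c *
  -- (2 * δ)`.
  obtain ⟨δ₀, hδ₀, H⟩ := hg.mass_closedBall_le_of_hasDerivAt_zero hr hd
    (show (0 : ℝ) < c / 3 by positivity)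
  obtain ⟨δ, hδ, hδm⟩ := exists_between (show 0 < min δ₁ (δ₀ / 3) by positivity)
  have hδa : δ < δ₁ := hδm.trans_le (min_le_left _ _)
  have hδb : δ < δ₀ / 3 := hδm.trans_le (min_le_right _ _)
  set B := Metric.closedBall x δ
  let I : Set ℕ := {n | N < n ∧ (core q r n ∩ B).Nonempty}
  set U := ⋃ n ∈ I, core q r n
  have hI : I.Countable := to_countable I
  have hU : MeasurableSet U := MeasurableSet.biUnion hI fun n _ => measurableSet_core n
  have hE : MeasurableSet (B \ U) := measurableSet_closedBall.diff hU
  have hdisj : I.PairwiseDisjoint (core q r) := pairwise_disjoint_core.set_pairwise I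
  have hUmass : ENNReal.ofReal c * volume U ≤ mass g U := by
    rw [measure_biUnion hI hdisj fun n _ => measurableSet_core n,
      measure_biUnion hI hdisj fun n _ => measurableSet_core n, ← ENNReal.tsum_mul_left]
    refine ENNReal.tsum_le_tsum fun n => le_trans ?_ (hg.volume_core_le_mass hr n)
    gcongr
  have hEmass : ENNReal.ofReal c * volume (B \ U) ≤ mass g (B \ U) := by
    refine ofReal_mul_volume_le_mass hE fun y hy => hball (lt_of_le_of_lt hy.1 hδa) ?_
    exact fun n hn hyn => hy.2 (mem_biUnion (show n ∈ I from ⟨hn, y, hyn, hy.1⟩) hyn)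
  have hUB : U ⊆ Metric.closedBall x (3 * δ) := by
    refine iUnion₂_subset fun n hn => ?_
    obtain ⟨hnN, y, hyn, hyB⟩ := hn
    -- Here `2 * r n < |x - q n| ≤ δ + r n`, so `r n < δ` and the whole core stays within `3 * δ` of
    -- `x`.
    have h1 := hN n hnN.le
    have h2 : |y - q n| ≤ r n := core_subset n hyn
    have h3 : |y - x| ≤ δ := hyB
    have h4 : |x - q n| ≤ |y - x| + |y - q n| := by
      rw [abs_sub_comm y x]; exact abs_sub_le _ _ _
    refine (core_subset n).trans (Metric.closedBall_subset_closedBall' ?_)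
    rw [dist_comm, Real.dist_eq]
    linarith
  have hEU : (B \ U) ∪ U ⊆ Metric.closedBall x (3 * δ) :=
    union_subset (sdiff_subset.trans (Metric.closedBall_subset_closedBall (by linarith))) hUB
  have hmain : ENNReal.ofReal (c * (2 * δ)) ≤ ENNReal.ofReal (c / 3 * (3 * δ)) := calc
    ENNReal.ofReal (c * (2 * δ)) = ENNReal.ofReal c * volume B := by
      rw [Real.volume_closedBall, ENNReal.ofReal_mul hc.le]
    _ ≤ ENNReal.ofReal c * (volume (B \ U) + volume U) := by
      gcongr
      refine (measure_mono ?_).trans (measure_union_le _ _)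
      rw [sdiff_union_self]
      exact subset_union_left
    _ ≤ mass g (B \ U) + mass g U := by rw [mul_add]; gcongr
    _ = mass g ((B \ U) ∪ U) := (measure_union disjoint_sdiff_left hU).symm
    _ ≤ mass g (Metric.closedBall x (3 * δ)) := measure_mono hEU
    _ ≤ _ := H _ (by positivity) (by linarith)
  rw [ENNReal.ofReal_le_ofReal_iff (by positivity)] at hmain
  nlinarith [mul_pos hc hδ]

theorem hasDerivAt_zero_iff (hg : CoreDensity q r g) (hr : SparseRadii q r) {x : ℝ} :
    HasDerivAt (fun x => ∫ t in 0..x, g t) 0 x ↔ x ∈ range q := by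
  refine ⟨fun h => ?_, ?_⟩
  · by_contra hx
    by_cases hf : ∃ᶠ n in atTop, |x - q n| ≤ 2 * r n
    · exact hg.not_hasDerivAt_zero_of_frequently hr hf h
    · rw [not_frequently] at hf
      exact hg.not_hasDerivAt_zero_of_eventually hr hx (hf.mono fun n hn => not_le.1 hn) h
  · rintro ⟨m, rfl⟩
    exact hg.hasDerivAt_zero hr m

end CoreDensity

theorem theorem1 :
    ∃ f : ℝ → ℝ,
      StrictMonoOn f (Set.Icc 0 1) ∧
      AbsolutelyContinuousOnInterval f 0 1 ∧
      {x : ℝ | x ∈ Set.Icc 0 1 ∧ HasDerivWithinAt f 0 (Set.Icc 0 1) x}.Countable ∧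
      Set.Icc 0 1 ⊆
        closure {x : ℝ | x ∈ Set.Icc 0 1 ∧ HasDerivWithinAt f 0 (Set.Icc 0 1) x} := by
  obtain ⟨e⟩ : Nonempty (ℕ ≃ ℚ) := ⟨(Denumerable.eqv ℚ).symm⟩
  let q : ℕ → ℝ := fun n => (e n : ℝ)
  have hq : Function.Injective q := Rat.cast_injective.comp e.injective
  have hdense : Dense (range q) :=
    Rat.denseRange_cast.comp e.surjective.denseRange Rat.continuous_coe_real
  obtain ⟨r, hr⟩ := exists_sparseRadii hq
  obtain ⟨g, hg⟩ := exists_coreDensity q r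
  refine ⟨fun x => ∫ t in 0..x, g t, (hg.strictMono hr).strictMonoOn _,
    ((hg.lipschitzWith hr).lipschitzOnWith).absolutelyContinuousOnInterval, ?_, ?_⟩
  -- At the endpoints the derivative is one-sided and the criterion does not apply, so both are
  -- simply added to the countable set.
  · refine ((countable_range q).union (Set.Finite.countable (toFinite {0, 1}))).mono ?_
    rintro x ⟨hx, hd⟩
    by_cases h0 : x = 0
    · exact Or.inr (by simp [h0])
    by_cases h1 : x = 1
    · exact Or.inr (by simp [h1])
    have hnhds : Icc (0 : ℝ) 1 ∈ 𝓝 x :=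
      Icc_mem_nhds (lt_of_le_of_ne hx.1 (Ne.symm h0)) (lt_of_le_of_ne hx.2 h1)
    exact Or.inl ((hg.hasDerivAt_zero_iff hr).1 (hd.hasDerivAt hnhds))
  · rw [← closure_Ioo (zero_ne_one' ℝ)]
    refine closure_minimal ((hdense.open_subset_closure_inter isOpen_Ioo).trans
      (closure_mono ?_)) isClosed_closure
    rintro x ⟨hx, hxq⟩
    rw [closure_Ioo (zero_ne_one' ℝ)]
    exact ⟨Ioo_subset_Icc_self hx, ((hg.hasDerivAt_zero_iff hr).2 hxq).hasDerivWithinAt⟩
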